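/- For $n\ge 1$ let $C_n=\{\pm1\}^n\rtimes \mathfrak{S}_n$ be the group of signed permutations of $n$ coordinates (the symmetric group $\mathfrak{S}_n$ acting on $\{\pm1\}^n$ by permuting coordinates), i.e. the symmetry group of the $n$-dimensional hypercube, of order $2^n n!$. Let $\operatorname{End}(C_n)$ be the finite set of group homomorphisms $C_n\to C_n$, and let $\varphi$ be drawn uniformly at random from $\operatorname{End}(C_n)$. Then $$\lim_{n\to\infty}\mathbb{P}_{\varphi\in\operatorname{End}(C_n)}\big[\operatorname{im}(\varphi)\trianglelefteq C_n\big]=\lim_{n\to\infty}\frac{\#\{\varphi\in\operatorname{End}(C_n):\ \varphi(C_n)\text{ is a normal subgroup of }C_n\}}{\#\operatorname{End}(C_n)}=\frac12 .$$ -/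

import Mathlib

/-- The group `C_n = {±1}^n ⋊ S_n` of signed permutations of `n` coordinates (the symmetry group of
the `n`-dimensional hypercube): `(x, σ)` acts on `ℝⁿ` by `e_i ↦ x (σ i) • e_(σ i)`.  The symmetric
group acts on sign vectors by permuting coordinates: `(σ • x) i = x (σ⁻¹ i)`. -/
abbrev SignedPermGroup (n : ℕ) : Type :=
  SemidirectProduct (Fin n → ℤˣ) (Equiv.Perm (Fin n)) mulAutArrow

/-- The probability that a uniformly random element of the finite nonempty type `α`
satisfies `P`. -/
noncomputable def uniformProb (α : Type) [Finite α] [Nonempty α] (P : α → Prop) : ℝ :=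
  (Nat.card {a : α // P a} : ℝ) / (Nat.card α : ℝ)

instance SignedPermGroup.instFinite (n : ℕ) : Finite (SignedPermGroup n) :=
  Finite.of_equiv _ SemidirectProduct.equivProd.symm

instance SignedPermGroup.instFiniteEnd (n : ℕ) :
    Finite (SignedPermGroup n →* SignedPermGroup n) :=
  DFunLike.finite _

/-! Restrict an endomorphism φ to S_n and project back to S_n. For n ≥ 7 the result is either
injective, hence conjugation by a unique τ (`exists_eq_conj_of_injective`), or it kills A_n. In the
latter case φ itself kills A_n, because A_n is perfect and sign vectors commute
(`covers_or_map_alternatingGroup_eq_one`).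

In the first case φ acts on sign vectors by an equivariant matrix with diagonal entry a and
off-diagonal entry b, and its image is normal iff a ≠ b. Multiplying φ by the relabelled sign vector
of its argument negates a alone, so `twist` is an involution exchanging normal and non-normal
images: exactly half of these φ count.

In the second case φ is determined by two commuting elements of exponent two. There are at most 4^n
times as many such pairs as in S_n, where they number O(n!/8^n). The first case has at least n!
members, so the second has vanishing weight. -/

open Equiv Equiv.Perm

/-! ### Injective endomorphisms of symmetric groups -/

namespace Equiv.Perm

variable {α : Type*}

/-- Disjoint or equal transpositions commute; two sharing one point multiply to a 3-cycle. This
property singles out transpositions among involutions and is preserved by homomorphisms. -/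
theorem IsSwap.mul_pow_two_or_three [DecidableEq α] {s t : Perm α} (hs : s.IsSwap) (ht : t.IsSwap) :
    (s * t) ^ 2 = 1 ∨ (s * t) ^ 3 = 1 := by
  obtain ⟨a, b, hab, rfl⟩ := hs
  obtain ⟨c, d, hcd, rfl⟩ := ht
  by_cases h : (a ≠ c ∧ a ≠ d) ∧ b ≠ c ∧ b ≠ d
  · left
    ext x
    simp only [pow_two, mul_apply, one_apply, swap_apply_def]
    grind
  · by_cases h' : (a = c ∧ b = d) ∨ (a = d ∧ b = c)
    · left
      ext x
      simp only [pow_two, mul_apply, one_apply, swap_apply_def]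
      grind
    · right
      ext x
      simp only [pow_succ, pow_zero, mul_apply, one_apply, swap_apply_def]
      grind

theorem conj_apply_eq_of_apply_eq {ρ t : Perm α} {x y u v : α} (hu : ρ x = u) (hv : ρ y = v)
    (h : t x = y) : (ρ * t * ρ⁻¹) u = v := by
  subst hu hv h
  simp

variable [DecidableEq α]

/-- An involution moving at least four points of a set with at least seven elements has a conjugate
such that the product of the two has order neither two nor three. -/
theorem exists_conj_mul_pow_ne_one [Fintype α] (hα : 7 ≤ Fintype.card α) {t : Perm α}
    (ht : t * t = 1) (h1 : t ≠ 1) (hs : ¬ t.IsSwap) :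
    ∃ ρ : Perm α, (t * (ρ * t * ρ⁻¹)) ^ 2 ≠ 1 ∧ (t * (ρ * t * ρ⁻¹)) ^ 3 ≠ 1 := by
  have hinv : ∀ x, t (t x) = x := fun x => by rw [← mul_apply, ht, one_apply]
  obtain ⟨a, ha⟩ : ∃ a, t a ≠ a := by
    by_contra! h
    exact h1 (ext h)
  obtain ⟨b, hb⟩ : ∃ b, t a = b := ⟨_, rfl⟩
  have hba : t b = a := by rw [← hb, hinv]
  obtain ⟨c, hca, hcb, hc⟩ : ∃ c, c ≠ a ∧ c ≠ b ∧ t c ≠ c := by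
    by_contra! h
    refine hs ⟨a, b, by grind, ext fun x => ?_⟩
    rw [swap_apply_def]
    grind
  obtain ⟨d, hd⟩ : ∃ d, t c = d := ⟨_, rfl⟩
  have hdc : t d = c := by rw [← hd, hinv]
  by_cases hfix : ∃ e, t e = e
  · obtain ⟨e, he⟩ := hfix
    have hnd : a ≠ b ∧ a ≠ c ∧ a ≠ d ∧ a ≠ e ∧ b ≠ c ∧ b ≠ d ∧ b ≠ e ∧ c ≠ d ∧ c ≠ e ∧ d ≠ e := by
      grind
    -- Chosen so that the product of `t` and its conjugate sends d → c → a → e, four distinct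
    -- points.
    obtain ⟨ρ, hρ⟩ : ∃ ρ : Perm α, ρ = swap a c * swap d e := ⟨_, rfl⟩
    have k1 : (ρ * t * ρ⁻¹) d = d :=
      conj_apply_eq_of_apply_eq (x := e) (y := e) (by simp [hρ, swap_apply_def]; grind)
        (by simp [hρ, swap_apply_def]; grind) he
    have k2 : (ρ * t * ρ⁻¹) c = b :=
      conj_apply_eq_of_apply_eq (x := a) (y := b) (by simp [hρ, swap_apply_def]; grind)
        (by simp [hρ, swap_apply_def]; grind) hb
    have k3 : (ρ * t * ρ⁻¹) a = e :=
      conj_apply_eq_of_apply_eq (x := c) (y := d) (by simp [hρ, swap_apply_def]; grind)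
        (by simp [hρ, swap_apply_def]; grind) hd
    have s1 : (t * (ρ * t * ρ⁻¹)) d = c := by rw [mul_apply, k1, hdc]
    have s2 : (t * (ρ * t * ρ⁻¹)) c = a := by rw [mul_apply, k2, hba]
    have s3 : (t * (ρ * t * ρ⁻¹)) a = e := by rw [mul_apply, k3, he]
    refine ⟨ρ, fun h => ?_, fun h => ?_⟩
    · have := congr($h d)
      rw [pow_two, mul_apply, s1, s2, one_apply] at this
      grind
    · have := congr($h d)
      rw [pow_succ, pow_two, mul_apply, mul_apply, s1, s2, s3, one_apply] at this
      grind
  -- Without fixed points, seven points force a fourth 2-cycle. On six points the claim fails for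
  -- products of three transpositions, the source of the outer automorphism of S_6.
  · push Not at hfix
    have hex : ∀ s : Finset α, s.card ≤ 6 → ∃ x, x ∉ s := fun s hs => by
      by_contra! h
      rw [Finset.eq_univ_of_forall h, Finset.card_univ] at hs
      omega
    obtain ⟨e, he⟩ := hex {a, b, c, d} (Finset.card_le_four.trans (by norm_num))
    obtain ⟨f, hf⟩ : ∃ f, t e = f := ⟨_, rfl⟩
    have hfe : t f = e := by rw [← hf, hinv]
    obtain ⟨g, hg⟩ := hex {a, b, c, d, e, f} Finset.card_le_six
    obtain ⟨k, hk⟩ : ∃ k, t g = k := ⟨_, rfl⟩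
    have hkg : t k = g := by rw [← hk, hinv]
    simp only [Finset.mem_insert, Finset.mem_singleton, not_or] at he hg
    have := hfix e
    have := hfix g
    have hnd : [a, b, c, d, e, f, g, k].Nodup := by
      simp only [List.nodup_cons, List.mem_cons, List.not_mem_nil, or_false, not_or,
        not_false_eq_true, List.nodup_nil, and_true]
      refine ⟨⟨?_, ?_, ?_, ?_, ?_, ?_, ?_⟩, ⟨?_, ?_, ?_, ?_, ?_, ?_⟩, ⟨?_, ?_, ?_, ?_, ?_⟩,
        ⟨?_, ?_, ?_, ?_⟩, ⟨?_, ?_, ?_⟩, ⟨?_, ?_⟩, ?_⟩ <;> grind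
    simp only [List.nodup_cons, List.mem_cons, List.not_mem_nil, or_false, not_or,
        not_false_eq_true, List.nodup_nil, and_true] at hnd
    -- Chosen so that the product sends a → g → e → c.
    obtain ⟨ρ, hρ⟩ : ∃ ρ : Perm α, ρ = swap b d * swap b f * swap b k := ⟨_, rfl⟩
    have k1 : (ρ * t * ρ⁻¹) a = k :=
      conj_apply_eq_of_apply_eq (x := a) (y := b) (by simp [hρ, swap_apply_def]; grind) (by simp [hρ, swap_apply_def]; grind) hb
    have k2 : (ρ * t * ρ⁻¹) g = f :=
      conj_apply_eq_of_apply_eq (x := g) (y := k) (by simp [hρ, swap_apply_def]; grind) (by simp [hρ, swap_apply_def]; grind) hk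
    have k3 : (ρ * t * ρ⁻¹) e = d :=
      conj_apply_eq_of_apply_eq (x := e) (y := f) (by simp [hρ, swap_apply_def]; grind) (by simp [hρ, swap_apply_def]; grind) hf
    have s1 : (t * (ρ * t * ρ⁻¹)) a = g := by rw [mul_apply, k1, hkg]
    have s2 : (t * (ρ * t * ρ⁻¹)) g = e := by rw [mul_apply, k2, hfe]
    have s3 : (t * (ρ * t * ρ⁻¹)) e = c := by rw [mul_apply, k3, hdc]
    refine ⟨ρ, fun h => ?_, fun h => ?_⟩
    · have := congr($h a)
      rw [pow_two, mul_apply, s1, s2, one_apply] at this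
      grind
    · have := congr($h a)
      rw [pow_succ, pow_two, mul_apply, mul_apply, s1, s2, s3, one_apply] at this
      grind

/-- In degree at least seven, injective endomorphisms preserve transpositions. -/
theorem isSwap_map_of_injective [Fintype α] (hα : 7 ≤ Fintype.card α) {f : Perm α →* Perm α}
    (hf : Function.Injective f) {s : Perm α} (hs : s.IsSwap) : (f s).IsSwap := by
  by_contra h
  have hs2 : s * s = 1 := by
    obtain ⟨a, b, -, rfl⟩ := hs
    exact swap_mul_self a b
  have hs1 : s ≠ 1 := by
    obtain ⟨a, b, hab, rfl⟩ := hs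
    exact fun h => hab (swap_eq_one_iff.1 h)
  obtain ⟨ρ, h2, h3⟩ := exists_conj_mul_pow_ne_one hα (t := f s) (by rw [← map_mul, hs2, map_one])
    (fun h => hs1 (hf (h.trans (map_one f).symm))) h
  obtain ⟨ρ', rfl⟩ := Finite.surjective_of_injective hf ρ
  have hconj : (ρ' * s * ρ'⁻¹).IsSwap := by
    obtain ⟨a, b, hab, rfl⟩ := hs
    exact ⟨ρ' a, ρ' b, ρ'.injective.ne hab, (swap_apply_apply ρ' a b).symm⟩
  rw [← map_inv, ← map_mul, ← map_mul, ← map_mul, ← map_pow] at h2 h3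
  rcases hs.mul_pow_two_or_three hconj with h | h
  · exact h2 (by rw [h, map_one])
  · exact h3 (by rw [h, map_one])

theorem IsSwap.eq_swap_of_apply_ne {s : Perm α} (hs : s.IsSwap) {p : α} (hp : s p ≠ p) :
    s = swap p (s p) := by
  obtain ⟨a, b, hab, rfl⟩ := hs
  ext x
  simp only [swap_apply_def] at *
  grind

/-- Every injective endomorphism of the symmetric group on at least seven letters is inner. -/
theorem exists_eq_conj_of_injective [Fintype α] (hα : 7 ≤ Fintype.card α) {f : Perm α →* Perm α}
    (hf : Function.Injective f) : ∃ τ : Perm α, ∀ σ, f σ = τ * σ * τ⁻¹ := by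
  have hex : ∀ s : Finset α, s.card ≤ 6 → ∃ x, x ∉ s := fun s hs => by
    by_contra! h
    rw [Finset.eq_univ_of_forall h, Finset.card_univ] at hs
    omega
  obtain ⟨o, -⟩ := hex ∅ (by simp)
  obtain ⟨i, hi⟩ := hex {o} (by simp)
  obtain ⟨j, hj⟩ := hex {o, i} (Finset.card_le_two.trans (by norm_num))
  simp only [Finset.mem_insert, Finset.mem_singleton, not_or] at hi hj
  have hsw : ∀ {x y : α}, x ≠ y → (f (swap x y)).IsSwap := fun {x y} h =>
    isSwap_map_of_injective hα hf ⟨x, y, h, rfl⟩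
  have hnc : ∀ {x y : α}, x ≠ o → y ≠ o → x ≠ y →
      f (swap o x) * f (swap o y) ≠ f (swap o y) * f (swap o x) := by
    intro x y hx hy hxy h
    rw [← map_mul, ← map_mul] at h
    have := congr($(hf h) x)
    simp only [mul_apply, swap_apply_def] at this
    grind
  -- Non-commuting transpositions share exactly one point. The images of `swap o i` and `swap o j`
  -- share p; another image avoiding p would have to be `swap q r`, already the image of `swap i j`.
  obtain ⟨p, hp⟩ : ∃ p, ∀ x, x ≠ o → f (swap o x) p ≠ p := by
    have hcomm : ∀ {s t : Perm α}, s.IsSwap → t.IsSwap → s * t ≠ t * s →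
        ∃ p q r, p ≠ q ∧ p ≠ r ∧ q ≠ r ∧ s = swap p q ∧ t = swap p r := by
      rintro _ _ ⟨a, b, hab, rfl⟩ ⟨c, d, hcd, rfl⟩ h
      by_cases hac : a = c
      · subst hac
        exact ⟨a, b, d, hab, hcd, by rintro rfl; exact h rfl, rfl, rfl⟩
      by_cases had : a = d
      · subst had
        exact ⟨a, b, c, hab, hcd.symm, by rintro rfl; exact h (by rw [swap_comm]), rfl,
          swap_comm _ _⟩
      by_cases hbc : b = c
      · subst hbc
        exact ⟨b, a, d, hab.symm, hcd, had, swap_comm _ _, rfl⟩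
      by_cases hbd : b = d
      · subst hbd
        exact ⟨b, a, c, hab.symm, hcd.symm, hac, swap_comm _ _, swap_comm _ _⟩
      refine absurd ?_ h
      ext x
      simp only [mul_apply, swap_apply_def]
      grind
    obtain ⟨p, q, r, hpq, hpr, hqr, h1, h2⟩ :=
      hcomm (hsw (Ne.symm hi)) (hsw (Ne.symm hj.1)) (hnc hi hj.1 (Ne.symm hj.2))
    refine ⟨p, fun x hx hxp => ?_⟩
    by_cases hxi : x = i
    · rw [hxi, h1, swap_apply_left] at hxp
      exact hpq hxp.symm
    by_cases hxj : x = j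
    · rw [hxj, h2, swap_apply_left] at hxp
      exact hpr hxp.symm
    have n1 := hnc hx hi hxi
    have n2 := hnc hx hj.1 hxj
    rw [h1] at n1
    rw [h2] at n2
    have h3 : f (swap i j) = swap q r := by
      rw [← swap_mul_swap_mul_swap (x := j) (y := o) (z := i) hj.1 hj.2, map_mul, map_mul,
        h1, swap_comm j o, h2]
      ext y
      simp only [mul_apply, swap_apply_def]
      grind
    have hx' := hsw (Ne.symm hx)
    have h4 : f (swap o x) = swap q r := by
      obtain ⟨a, b, hab, hs⟩ := hx'
      rw [hs] at hxp n1 n2 ⊢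
      have hap : p ≠ a ∧ p ≠ b := by
        rw [swap_apply_def] at hxp
        grind
      have haq : a = q ∨ b = q := by
        by_contra! hcon
        refine n1 ?_
        ext y
        simp only [mul_apply, swap_apply_def]
        grind
      have har : a = r ∨ b = r := by
        by_contra! hcon
        refine n2 ?_
        ext y
        simp only [mul_apply, swap_apply_def]
        grind
      rcases haq with rfl | rfl
      · rw [har.resolve_left hqr]
      · rw [har.resolve_right hqr, swap_comm]
    have h5 := congr($(hf (h4.trans h3.symm)) o)
    rw [swap_apply_left, swap_apply_of_ne_of_ne (Ne.symm hi) (Ne.symm hj.1)] at h5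
    exact hx h5
  have hfp : ∀ x, x ≠ o → f (swap o x) = swap p (f (swap o x) p) := fun x hx =>
    (hsw (Ne.symm hx)).eq_swap_of_apply_ne (hp x hx)
  have hinj : Function.Injective fun x => f (swap o x) p := by
    intro x y hxy
    by_cases hx : x = o
    · by_cases hy : y = o
      · rw [hx, hy]
      · subst hx
        simp only [swap_self, ← one_def, map_one, one_apply] at hxy
        exact absurd hxy.symm (hp y hy)
    · by_cases hy : y = o
      · subst hy
        simp only [swap_self, ← one_def, map_one, one_apply] at hxy
        exact absurd hxy (hp x hx)
      · have h : f (swap o x) = f (swap o y) := by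
          rw [hfp x hx, hfp y hy]
          exact congrArg (swap p) hxy
        have := congr($(hf h) o)
        rwa [swap_apply_left, swap_apply_left] at this
  -- At x = o the swap is trivial, so this formula also gives τ o = p.
  obtain ⟨τ, hτ⟩ : ∃ τ : Perm α, ∀ x, τ x = f (swap o x) p :=
    ⟨Equiv.ofBijective _ (Finite.injective_iff_bijective.1 hinj), fun x => rfl⟩
  have hτo : τ o = p := by simp [hτ, ← one_def]
  have h0 : ∀ x, f (swap o x) = τ * swap o x * τ⁻¹ := by
    intro x
    rw [← swap_apply_apply, hτo]
    by_cases hx : x = o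
    · subst hx
      rw [hτo]
      simp [← one_def]
    · rw [hfp x hx, hτ x]
  refine ⟨τ, fun σ => ?_⟩
  have heq : f = (MulAut.conj τ).toMonoidHom := by
    refine MonoidHom.eq_of_eqOn_dense closure_isSwap ?_
    rintro _ ⟨x, y, hxy, rfl⟩
    change f (swap x y) = τ * swap x y * τ⁻¹
    by_cases hx : x = o
    · rw [hx, h0]
    by_cases hy : y = o
    · rw [hy, swap_comm, h0]
    · rw [← swap_mul_swap_mul_swap (x := y) (y := o) (z := x) hy (Ne.symm hxy), map_mul, map_mul,
        swap_comm y o, h0, h0]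
      group
  rw [heq]
  rfl

end Equiv.Perm

/-! ### Counting pairs of commuting involutions in S_n -/

/-- Pairs of commuting elements of exponent two, i.e. homomorphisms from the Klein four-group. -/
def commInvolutionPairs (G : Type*) [Group G] : Set (G × G) :=
  {p | p.1 * p.1 = 1 ∧ p.2 * p.2 = 1 ∧ p.1 * p.2 = p.2 * p.1}

section counting

variable {α : Type*}

/-- `S` is the orbit of x under the pair. Commutation forces both permutations on `S`, so a pair is
determined by its restriction to the complement. -/
theorem ncard_commInvolutionPairs_fiber_le [Finite α] (x y z w : α) {S : Set α}
    (hS : S = {x, y, z, w}) :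
    {p ∈ commInvolutionPairs (Perm α) | p.1 x = y ∧ p.2 x = z ∧ p.1 z = w}.ncard ≤
      (commInvolutionPairs (Perm {u // u ∉ S})).ncard := by
  rw [← Nat.card_coe_set_eq, ← Nat.card_coe_set_eq]
  have hinv : ∀ {f : Perm α}, f * f = 1 → ∀ u, f (f u) = u := fun h u => by
    rw [← mul_apply, h, one_apply]
  have key : ∀ p ∈ {p ∈ commInvolutionPairs (Perm α) | p.1 x = y ∧ p.2 x = z ∧ p.1 z = w},
      (p.1 x = y ∧ p.1 y = x ∧ p.1 z = w ∧ p.1 w = z) ∧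
      (p.2 x = z ∧ p.2 z = x ∧ p.2 y = w ∧ p.2 w = y) := by
    rintro ⟨a, b⟩ ⟨⟨ha, hb, hab⟩, h1, h2, h3⟩
    simp only at ha hb hab h1 h2 h3 ⊢
    have h4 : b y = w := by
      rw [← h1, ← h3, ← h2, ← mul_apply, ← mul_apply, hab]
    exact ⟨⟨h1, by rw [← h1, hinv ha], h3, by rw [← h3, hinv ha]⟩,
      h2, by rw [← h2, hinv hb], h4, by rw [← h4, hinv hb]⟩
  have stable : ∀ {f : Perm α}, f * f = 1 → (∀ u ∈ S, f u ∈ S) → ∀ u, f u ∉ S ↔ u ∉ S := by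
    intro f hf h u
    refine not_congr ⟨fun hu => ?_, h u⟩
    simpa [hinv hf] using h _ hu
  have st1 : ∀ p : {p ∈ commInvolutionPairs (Perm α) | p.1 x = y ∧ p.2 x = z ∧ p.1 z = w},
      ∀ u, p.1.1 u ∉ S ↔ u ∉ S := by
    intro p
    refine stable p.2.1.1 fun u hu => ?_
    obtain ⟨⟨k1, k2, k3, k4⟩, -⟩ := key p.1 p.2
    rw [hS] at hu ⊢
    rcases hu with rfl | rfl | rfl | rfl <;> simp [*]
  have st2 : ∀ p : {p ∈ commInvolutionPairs (Perm α) | p.1 x = y ∧ p.2 x = z ∧ p.1 z = w},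
      ∀ u, p.1.2 u ∉ S ↔ u ∉ S := by
    intro p
    refine stable p.2.1.2.1 fun u hu => ?_
    obtain ⟨-, k1, k2, k3, k4⟩ := key p.1 p.2
    rw [hS] at hu ⊢
    rcases hu with rfl | rfl | rfl | rfl <;> simp [*]
  refine Nat.card_le_card_of_injective
    (fun p => ⟨(p.1.1.subtypePerm (st1 p), p.1.2.subtypePerm (st2 p)), ?_, ?_, ?_⟩) ?_
  · ext u
    simp [hinv p.2.1.1]
  · ext u
    simp [hinv p.2.1.2.1]
  · ext u
    exact congr($(p.2.1.2.2) u)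
  · intro p q hpq
    obtain ⟨⟨k1, k2, k3, k4⟩, l1, l2, l3, l4⟩ := key p.1 p.2
    obtain ⟨⟨m1, m2, m3, m4⟩, n1, n2, n3, n4⟩ := key q.1 q.2
    obtain ⟨hpq1, hpq2⟩ := Prod.mk.inj (congrArg Subtype.val hpq)
    refine Subtype.ext (Prod.ext (Equiv.ext fun u => ?_) (Equiv.ext fun u => ?_))
    · by_cases hu : u ∈ S
      · rw [hS] at hu
        rcases hu with rfl | rfl | rfl | rfl <;> simp [*]
      · exact congr(($hpq1 ⟨u, hu⟩ : α))
    · by_cases hu : u ∈ S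
      · rw [hS] at hu
        rcases hu with rfl | rfl | rfl | rfl <;> simp [*]
      · exact congr(($hpq2 ⟨u, hu⟩ : α))

/-- Splitting off the orbit of a point under a pair of commuting involutions. -/
theorem ncard_commInvolutionPairs_perm_le [Finite α] {g : ℕ → ℝ}
    (hg : ∀ S : Set α, S.Nonempty →
      ((commInvolutionPairs (Perm {u // u ∉ S})).ncard : ℝ) ≤ g (Nat.card α - S.ncard))
    (hg0 : ∀ n, 0 ≤ g n) (x : α) :
    ((commInvolutionPairs (Perm α)).ncard : ℝ) ≤ g (Nat.card α - 1) +
      Nat.card α * (3 * g (Nat.card α - 2)) + Nat.card α ^ 3 * g (Nat.card α - 4) := by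
  classical
  have := Fintype.ofFinite α
  set n := Nat.card α with hn
  set F : α → α → α → Finset (Perm α × Perm α) := fun y z w =>
    {p ∈ commInvolutionPairs (Perm α) | p.1 x = y ∧ p.2 x = z ∧ p.1 z = w}.toFinset with hF
  have hFle : ∀ y z w, ((F y z w).card : ℝ) ≤ g (n - ({x, y, z, w} : Set α).ncard) := by
    intro y z w
    refine le_trans ?_ (hg {x, y, z, w} ⟨x, by simp⟩)
    rw [hF, ← Set.ncard_eq_toFinset_card']
    exact_mod_cast ncard_commInvolutionPairs_fiber_le x y z w rfl
  set T : Finset (α × α × α) := Finset.univ.filter fun t => ({x, t.1, t.2.1, t.2.2} : Set α).ncard = 4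
    with hT
  -- The orbit of x has 1, 2 or 4 points; a two-point orbit occurs in three ways, according to which
  -- of a, b, ab fixes x.
  have hcover : (commInvolutionPairs (Perm α)).toFinset ⊆
      (F x x x ∪ (Finset.univ.erase x).biUnion fun u => (F x u u ∪ F u x u) ∪ F u u x) ∪
        T.biUnion fun t => F t.1 t.2.1 t.2.2 := by
    rintro ⟨a, b⟩ hp
    rw [Set.mem_toFinset] at hp
    have hp' := hp
    obtain ⟨ha, hb, hab⟩ := hp'
    simp only at ha hb hab
    have hab' : ∀ u, a (b u) = b (a u) := fun u => by rw [← mul_apply, hab, mul_apply]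
    have ha' : ∀ u, a (a u) = u := fun u => by rw [← mul_apply, ha, one_apply]
    have hb' : ∀ u, b (b u) = u := fun u => by rw [← mul_apply, hb, one_apply]
    simp only [Finset.mem_union, Finset.mem_biUnion, hF, Set.mem_toFinset, Set.mem_ofPred_eq, hp,
      true_and, Finset.mem_erase, Finset.mem_univ, and_true, hT, Finset.mem_filter]
    by_cases h1 : a x = x
    · by_cases h2 : b x = x
      · simp [h1, h2]
      · exact Or.inl (Or.inr ⟨b x, h2, Or.inl (Or.inl ⟨h1, rfl, by rw [hab', h1]⟩)⟩)
    · by_cases h2 : b x = x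
      · exact Or.inl (Or.inr ⟨a x, h1, Or.inl (Or.inr ⟨rfl, h2, rfl⟩)⟩)
      · by_cases h3 : a x = b x
        · exact Or.inl (Or.inr ⟨a x, h1, Or.inr ⟨rfl, h3.symm, ha' x⟩⟩)
        · refine Or.inr ⟨(a x, b x, a (b x)), ?_, rfl, rfl, rfl⟩
          have e1 : x ≠ a (b x) := fun h => h3 (by rw [h, ha', ← h])
          have e2 : a x ≠ a (b x) := fun h => h2 (a.injective h).symm
          have e3 : b x ≠ a (b x) := fun h => h1 (b.injective (by rw [← hab', ← h]))
          rw [Set.ncard_insert_of_notMem, Set.ncard_insert_of_notMem, Set.ncard_pair e3]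
          · simp [h3, e2]
          · simp [Ne.symm h1, Ne.symm h2, e1]
  have hcard : ((commInvolutionPairs (Perm α)).ncard : ℝ) ≤
      ((F x x x).card + ∑ u ∈ Finset.univ.erase x,
        (((F x u u).card + (F u x u).card : ℝ) + (F u u x).card)) +
        ∑ t ∈ T, ((F t.1 t.2.1 t.2.2).card : ℝ) := by
    rw [Set.ncard_eq_toFinset_card']
    refine le_trans (Nat.cast_le.2 (Finset.card_le_card hcover)) ?_
    refine le_trans (Nat.cast_le.2 (Finset.card_union_le _ _)) ?_
    rw [Nat.cast_add]
    refine add_le_add ?_ ?_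
    · refine le_trans (Nat.cast_le.2 (Finset.card_union_le _ _)) ?_
      rw [Nat.cast_add]
      refine add_le_add le_rfl ?_
      refine le_trans (Nat.cast_le.2 Finset.card_biUnion_le) ?_
      rw [Nat.cast_sum]
      refine Finset.sum_le_sum fun u _ => ?_
      refine le_trans (Nat.cast_le.2 (Finset.card_union_le _ _)) ?_
      rw [Nat.cast_add]
      refine add_le_add ?_ le_rfl
      exact_mod_cast Finset.card_union_le _ _
    · exact_mod_cast Finset.card_biUnion_le
  refine hcard.trans (add_le_add (add_le_add ?_ ?_) ?_)
  · simpa using hFle x x x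
  · refine (Finset.sum_le_sum (g := fun _ => 3 * g (n - 2)) fun u hu => ?_).trans ?_
    · have hxu : x ≠ u := (Finset.ne_of_mem_erase hu).symm
      have i1 := hFle x u u
      have i2 := hFle u x u
      have i3 := hFle u u x
      have s1 : ({x, x, u, u} : Set α) = {x, u} := by simp
      have s2 : ({x, u, x, u} : Set α) = {x, u} := by grind
      have s3 : ({x, u, u, x} : Set α) = {x, u} := by grind
      rw [s1, Set.ncard_pair hxu] at i1
      rw [s2, Set.ncard_pair hxu] at i2
      rw [s3, Set.ncard_pair hxu] at i3
      linarith
    · rw [Finset.sum_const, nsmul_eq_mul]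
      refine mul_le_mul_of_nonneg_right ?_ (by linarith [hg0 (n - 2)])
      rw [hn, Nat.card_eq_fintype_card]
      exact_mod_cast (Finset.card_le_univ _)
  · refine (Finset.sum_le_sum (g := fun _ => g (n - 4)) fun t ht => ?_).trans ?_
    · have := hFle t.1 t.2.1 t.2.2
      rwa [(Finset.mem_filter.1 ht).2] at this
    · rw [Finset.sum_const, nsmul_eq_mul]
      refine mul_le_mul_of_nonneg_right ?_ (hg0 _)
      have : T.card ≤ n ^ 3 := (Finset.card_le_univ _).trans (by
        rw [Fintype.card_prod, Fintype.card_prod, hn, Nat.card_eq_fintype_card]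
        exact le_of_eq (by ring))
      exact_mod_cast this

/-- With P = (m+1)(m+2)(m+3), the three terms divided by C·m!/8^m are at most P/512, 6P/64 and 16P.
The right side becomes (m+4)P/4096, and 65928 = 4096·(1/512 + 6/64 + 16). -/
theorem factorial_div_recursion_le (C : ℝ) (hC : 0 ≤ C) (m : ℕ) (hm : 65928 ≤ m) :
    C * (m + 3).factorial / 8 ^ (m + 3) +
      ((m + 4 : ℕ) : ℝ) * (3 * (C * (m + 2).factorial / 8 ^ (m + 2))) +
      ((m + 4 : ℕ) : ℝ) ^ 3 * (C * m.factorial / 8 ^ m) ≤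
    C * (m + 4).factorial / 8 ^ (m + 4) := by
  have hm' : (65928 : ℝ) ≤ m := by exact_mod_cast hm
  have h0 : (0 : ℝ) ≤ C * m.factorial / 8 ^ m := by positivity
  simp only [Nat.factorial_succ, pow_succ]
  push_cast
  set x : ℝ := (m : ℝ)
  have key : ((x + 3) * (x + 2) * (x + 1) / 512 + 3 * (x + 4) * (x + 2) * (x + 1) / 64 +
      (x + 4) ^ 3) ≤ (x + 4) * (x + 3) * (x + 2) * (x + 1) / 4096 := by
    have hx : (0 : ℝ) ≤ x := by linarith
    have e1 : 3 * (x + 4) * (x + 2) * (x + 1) ≤ 6 * ((x + 3) * (x + 2) * (x + 1)) := by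
      nlinarith [mul_nonneg (mul_nonneg (by linarith : (0 : ℝ) ≤ x + 2)
        (by linarith : (0 : ℝ) ≤ x + 1)) hx]
    have e2 : (x + 4) ^ 3 ≤ 16 * ((x + 3) * (x + 2) * (x + 1)) := by
      nlinarith [pow_nonneg hx 3, pow_nonneg hx 2]
    have e3 : 65928 * ((x + 3) * (x + 2) * (x + 1)) ≤
        (x + 4) * ((x + 3) * (x + 2) * (x + 1)) :=
      mul_le_mul_of_nonneg_right (by linarith) (by positivity)
    linarith
  have := mul_le_mul_of_nonneg_right key h0
  refine le_trans (le_of_eq ?_) (this.trans (le_of_eq ?_))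
  · field_simp
    ring
  · field_simp
    ring

/-- The base 8 beats the 4^n choices of signs with a factor 2^n to spare. `C` absorbs the trivial
bound n!² below the threshold 65932 = 65928 + 4; the orbit recursion takes over from there. -/
theorem exists_ncard_commInvolutionPairs_perm_le : ∃ C : ℝ, 0 ≤ C ∧
    ∀ (n : ℕ) (α : Type) [Finite α], Nat.card α = n →
      ((commInvolutionPairs (Perm α)).ncard : ℝ) ≤ C * n.factorial / 8 ^ n := by
  obtain ⟨N, hN⟩ : ∃ N : ℕ, N = 65932 := ⟨_, rfl⟩
  obtain ⟨C, hC⟩ : ∃ C : ℝ, C = ∑ k ∈ Finset.range N, (k.factorial * 8 ^ k : ℝ) := ⟨_, rfl⟩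
  have hC0 : 0 ≤ C := hC ▸ Finset.sum_nonneg fun k _ => by positivity
  refine ⟨C, hC0, fun n => ?_⟩
  induction n using Nat.strong_induction_on with
  | _ n ih =>
  intro α _ hα
  by_cases hn : n < N
  · have h1 : (commInvolutionPairs (Perm α)).ncard ≤ n.factorial * n.factorial := by
      rw [← Nat.card_coe_set_eq]
      refine (Nat.card_le_card_of_injective _ Subtype.val_injective).trans ?_
      rw [Nat.card_prod, Nat.card_perm, hα]
    have h2 : (n.factorial * 8 ^ n : ℝ) ≤ C := hC ▸
      Finset.single_le_sum (f := fun k : ℕ => (k.factorial * 8 ^ k : ℝ))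
        (fun k _ => by positivity) (Finset.mem_range.2 hn)
    rw [le_div_iff₀ (by positivity)]
    calc ((commInvolutionPairs (Perm α)).ncard : ℝ) * 8 ^ n
        ≤ (n.factorial * n.factorial : ℝ) * 8 ^ n := by gcongr; exact_mod_cast h1
      _ = (n.factorial * 8 ^ n : ℝ) * n.factorial := by ring
      _ ≤ C * n.factorial := by gcongr
  · obtain ⟨m, rfl⟩ : ∃ m, n = m + 4 := ⟨n - 4, by omega⟩
    have : Nonempty α := (Nat.card_pos_iff.1 (by rw [hα]; exact Nat.succ_pos _)).1
    obtain ⟨x⟩ := this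
    have := ncard_commInvolutionPairs_perm_le (α := α)
      (g := fun k => C * k.factorial / 8 ^ k) (fun S hS => ?_) (fun k => by positivity) x
    · refine this.trans ?_
      rw [hα]
      exact factorial_div_recursion_le C hC0 m (by omega)
    · have hpos : 0 < S.ncard := (Set.ncard_pos (Set.toFinite S)).2 hS
      refine ih _ (by omega) _ ?_
      have := Set.ncard_add_ncard_compl S
      rw [← Nat.card_coe_set_eq Sᶜ] at this
      change Nat.card {u // u ∉ S} = _
      change S.ncard + Nat.card {u // u ∉ S} = _ at this
      omega

end counting

/-- If ρ moves j ≠ i, a transposition of j with some k outside {i, j, ρ j} fails to commute with ρ.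
Only swaps fixing i are required, as these are the ones commuting with the sign flip at i. -/
theorem Equiv.Perm.eq_one_of_commute_swap {α : Type*} [DecidableEq α] [Fintype α]
    (hα : 4 ≤ Fintype.card α) (i : α) {ρ : Perm α}
    (h : ∀ j k, j ≠ i → k ≠ i → ρ * swap j k = swap j k * ρ) : ρ = 1 := by
  have h1 : ∀ j, j ≠ i → ρ j = j := by
    intro j hj
    by_contra hne
    obtain ⟨k, hk⟩ : ∃ k, k ∉ ({i, j, ρ j} : Finset α) := by
      by_contra! hall
      have := Finset.card_le_three (a := i) (b := j) (c := ρ j)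
      rw [Finset.eq_univ_of_forall hall, Finset.card_univ] at this
      omega
    simp only [Finset.mem_insert, Finset.mem_singleton, not_or] at hk
    have := congr($(h j k hj hk.1) j)
    rw [mul_apply, mul_apply, swap_apply_left, swap_apply_of_ne_of_ne hne (Ne.symm hk.2.2)] at this
    exact hk.2.1 (ρ.injective this)
  ext j
  by_cases hj : j = i
  · by_contra hne
    have hne' : ρ j ≠ j := hne
    have := h1 (ρ j) (hj ▸ hne')
    exact hne' (ρ.injective this)
  · exact h1 j hj

/-! ### The dichotomy for endomorphisms of C_n -/

namespace SignedPermGroup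

open SemidirectProduct

variable {n : ℕ}

theorem mulAutArrow_apply (σ : Perm (Fin n)) (v : Fin n → ℤˣ) (i : Fin n) :
    (mulAutArrow σ : MulAut (Fin n → ℤˣ)) v i = v (σ⁻¹ i) := rfl

theorem mulAutArrow_mulSingle (σ : Perm (Fin n)) (i : Fin n) (x : ℤˣ) :
    (mulAutArrow σ : MulAut (Fin n → ℤˣ)) (Pi.mulSingle i x) = Pi.mulSingle (σ i) x := by
  ext j
  rw [mulAutArrow_apply, Pi.mulSingle_apply, Pi.mulSingle_apply]
  simp only [inv_eq_iff_eq]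

theorem mul_inl_mul_inv (g : SignedPermGroup n) (v : Fin n → ℤˣ) :
    g * inl v * g⁻¹ = inl ((mulAutArrow g.right : MulAut (Fin n → ℤˣ)) v) := by
  rw [mul_inv_eq_iff_eq_mul]
  refine SemidirectProduct.ext ?_ ?_
  · simp [mul_comm]
  · simp

theorem mem_of_mulSingle_neg_one_mem {H : Subgroup (Fin n → ℤˣ)}
    (h : ∀ i, Pi.mulSingle i (-1) ∈ H) (v : Fin n → ℤˣ) : v ∈ H := by
  refine Subgroup.pi_mem_of_mulSingle_mem v fun i => ?_
  rcases Int.units_eq_one_or (v i) with hi | hi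
  · rw [hi, Pi.mulSingle_one]
    exact H.one_mem
  · rw [hi]
    exact h i

/-- `φ` covers the inner automorphism of the symmetric group given by `τ`. -/
def Covers (φ : SignedPermGroup n →* SignedPermGroup n) (τ : Perm (Fin n)) : Prop :=
  ∀ σ, (φ (inr σ)).right = τ * σ * τ⁻¹

theorem covers_or_map_alternatingGroup_eq_one (hn : 7 ≤ n)
    (φ : SignedPermGroup n →* SignedPermGroup n) :
    (∃ τ, Covers φ τ) ∨ ∀ σ ∈ alternatingGroup (Fin n), φ (inr σ) = 1 := by
  have hcard : 5 ≤ Nat.card (Fin n) := by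
    rw [Nat.card_fin]
    omega
  set f : Perm (Fin n) →* Perm (Fin n) := (rightHom.comp φ).comp inr with hf
  by_cases hinj : Function.Injective f
  · left
    exact exists_eq_conj_of_injective (by rw [Fintype.card_fin]; exact hn) hinj
  · right
    have hker : alternatingGroup (Fin n) ≤ f.ker := by
      refine alternatingGroup_le_of_normal hcard ?_
      rw [Subgroup.nontrivial_iff_ne_bot]
      exact fun h => hinj ((MonoidHom.ker_eq_bot_iff f).1 h)
    suffices h : alternatingGroup (Fin n) ≤ (φ.comp inr).ker from fun σ hσ => h hσ
    rw [← commutator_alternatingGroup_eq_self hcard, Subgroup.commutator_le]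
    intro σ hσ ρ hρ
    have hV : ∀ σ ∈ alternatingGroup (Fin n), ∃ v, φ (inr σ) = inl v := fun σ hσ => by
      refine ⟨(φ (inr σ)).left, SemidirectProduct.ext rfl ?_⟩
      exact MonoidHom.mem_ker.1 (hker hσ)
    obtain ⟨v, hv⟩ := hV σ hσ
    obtain ⟨w, hw⟩ := hV ρ hρ
    rw [MonoidHom.mem_ker, map_commutatorElement, commutatorElement_eq_one_iff_commute]
    change φ (inr σ) * φ (inr ρ) = φ (inr ρ) * φ (inr σ)
    rw [hv, hw, ← map_mul, ← map_mul, mul_comm]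

/-! ### Endomorphisms killing A_n -/

section kills

variable {φ ψ : SignedPermGroup n →* SignedPermGroup n}

/-- A 3-cycle conjugates the flip at i to the flip at j, and φ kills it. -/
theorem map_inl_mulSingle_eq (hn : 3 ≤ n) (h : ∀ σ ∈ alternatingGroup (Fin n), φ (inr σ) = 1)
    (i j : Fin n) (x : ℤˣ) : φ (inl (Pi.mulSingle i x)) = φ (inl (Pi.mulSingle j x)) := by
  by_cases hij : i = j
  · rw [hij]
  obtain ⟨k, hk⟩ : ∃ k, k ∉ ({i, j} : Finset (Fin n)) := by
    by_contra! hall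
    have := Finset.card_le_two (a := i) (b := j)
    rw [Finset.eq_univ_of_forall hall, Finset.card_univ, Fintype.card_fin] at this
    omega
  simp only [Finset.mem_insert, Finset.mem_singleton, not_or] at hk
  have hσ : swap k j * swap i k ∈ alternatingGroup (Fin n) := by
    rw [mem_alternatingGroup, map_mul, sign_swap hk.2, sign_swap (Ne.symm hk.1)]
    rfl
  have hσi : (swap k j * swap i k) i = j := by simp
  have := mul_inl_mul_inv (inr (swap k j * swap i k)) (Pi.mulSingle i x)
  rw [right_inr, mulAutArrow_mulSingle, hσi] at this
  rw [← this, map_mul, map_mul, map_inv, h _ hσ, one_mul, inv_one, mul_one]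

theorem hom_ext_of_alternatingGroup (hn : 3 ≤ n) {i j : Fin n} (hij : i ≠ j)
    (hφ : ∀ σ ∈ alternatingGroup (Fin n), φ (inr σ) = 1)
    (hψ : ∀ σ ∈ alternatingGroup (Fin n), ψ (inr σ) = 1)
    (h1 : φ (inl (Pi.mulSingle i (-1))) = ψ (inl (Pi.mulSingle i (-1))))
    (h2 : φ (inr (swap i j)) = ψ (inr (swap i j))) : φ = ψ := by
  refine SemidirectProduct.hom_ext ?_ ?_
  · ext1 v
    have : v ∈ (φ.comp inl).eqLocus (ψ.comp inl) := by
      refine mem_of_mulSingle_neg_one_mem (fun k => ?_) v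
      change φ _ = ψ _
      rw [map_inl_mulSingle_eq hn hφ k i, map_inl_mulSingle_eq hn hψ k i, h1]
    exact this
  · refine MonoidHom.eq_of_eqOn_dense closure_isSwap ?_
    rintro _ ⟨k, l, hkl, rfl⟩
    change φ _ = ψ _
    have hσ : swap k l * swap i j ∈ alternatingGroup (Fin n) := by
      rw [mem_alternatingGroup, map_mul, sign_swap hkl, sign_swap hij]
      rfl
    have hs : swap k l = swap k l * swap i j * swap i j := by
      rw [mul_assoc, swap_mul_self, mul_one]
    rw [hs, map_mul inr, map_mul φ, map_mul ψ, hφ _ hσ, hψ _ hσ, h2]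

theorem mem_commInvolutionPairs (hn : 3 ≤ n)
    (hφ : ∀ σ ∈ alternatingGroup (Fin n), φ (inr σ) = 1) (i j : Fin n) :
    (φ (inl (Pi.mulSingle i (-1))), φ (inr (swap i j))) ∈
      commInvolutionPairs (SignedPermGroup n) := by
  refine ⟨?_, ?_, ?_⟩
  · change φ _ * φ _ = 1
    rw [← map_mul, ← map_mul, ← Pi.mulSingle_mul, Int.units_mul_self, Pi.mulSingle_one, map_one,
      map_one]
  · change φ _ * φ _ = 1
    rw [← map_mul, ← map_mul, swap_mul_self, map_one, map_one]
  · change φ _ * φ _ = φ _ * φ _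
    -- The flip at k commutes with `swap i j` and has the same image as the flip at i.
    obtain ⟨k, hk⟩ : ∃ k, k ∉ ({i, j} : Finset (Fin n)) := by
      by_contra! hall
      have := Finset.card_le_two (a := i) (b := j)
      rw [Finset.eq_univ_of_forall hall, Finset.card_univ, Fintype.card_fin] at this
      omega
    simp only [Finset.mem_insert, Finset.mem_singleton, not_or] at hk
    have := mul_inl_mul_inv (inr (swap i j)) (Pi.mulSingle k (-1))
    rw [right_inr, mulAutArrow_mulSingle, swap_apply_of_ne_of_ne hk.1 hk.2,
      mul_inv_eq_iff_eq_mul] at this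
    rw [map_inl_mulSingle_eq hn hφ i k, ← map_mul, ← map_mul, this]

end kills

/-! ### Endomorphisms covering an inner automorphism of S_n -/

section covers

variable {φ : SignedPermGroup n →* SignedPermGroup n} {τ τ' : Perm (Fin n)}

theorem Covers.unique (hn : 4 ≤ n) (h : Covers φ τ) (h' : Covers φ τ') : τ = τ' := by
  have : τ⁻¹ * τ' = 1 := by
    refine eq_one_of_commute_swap (by rwa [Fintype.card_fin]) ⟨0, by omega⟩ fun j k _ _ => ?_
    have := (h (swap j k)).symm.trans (h' (swap j k))
    rw [mul_inv_eq_iff_eq_mul] at this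
    calc τ⁻¹ * τ' * swap j k = τ⁻¹ * (τ' * swap j k * τ'⁻¹ * τ) * τ⁻¹ * τ' := by group
      _ = swap j k * (τ⁻¹ * τ') := by rw [← this]; group
  exact inv_mul_eq_one.1 this

theorem Covers.map_inl_right (hn : 4 ≤ n) (h : Covers φ τ) (v : Fin n → ℤˣ) :
    (φ (inl v)).right = 1 := by
  suffices hv : v ∈ (rightHom.comp (φ.comp inl)).ker from hv
  refine mem_of_mulSingle_neg_one_mem (fun i => ?_) v
  change (φ (inl (Pi.mulSingle i (-1)))).right = 1
  have hone : τ⁻¹ * (φ (inl (Pi.mulSingle i (-1)))).right * τ = 1 := by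
    refine eq_one_of_commute_swap (by rwa [Fintype.card_fin]) i fun j k hj hk => ?_
    have := mul_inl_mul_inv (inr (swap j k)) (Pi.mulSingle i (-1))
    rw [right_inr, mulAutArrow_mulSingle, swap_apply_of_ne_of_ne (Ne.symm hj) (Ne.symm hk),
      mul_inv_eq_iff_eq_mul] at this
    have := congr((φ $this).right)
    rw [map_mul, map_mul, mul_right, mul_right, h] at this
    calc τ⁻¹ * (φ (inl (Pi.mulSingle i (-1)))).right * τ * swap j k
        = τ⁻¹ * ((φ (inl (Pi.mulSingle i (-1)))).right * (τ * swap j k * τ⁻¹)) * τ := by group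
      _ = swap j k * (τ⁻¹ * (φ (inl (Pi.mulSingle i (-1)))).right * τ) := by
        rw [← this]
        group
  rwa [mul_eq_one_iff_eq_inv, inv_mul_eq_iff_eq_mul, mul_inv_cancel] at hone

theorem Covers.map_inl (hn : 4 ≤ n) (h : Covers φ τ) (v : Fin n → ℤˣ) :
    φ (inl v) = inl (φ (inl v)).left :=
  SemidirectProduct.ext rfl (h.map_inl_right hn v)

/-- The restriction of an endomorphism covering `τ` to sign vectors. -/
def Covers.leftHom (hn : 4 ≤ n) (h : Covers φ τ) : (Fin n → ℤˣ) →* (Fin n → ℤˣ) :=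
  MonoidHom.mk' (fun v => (φ (inl v)).left) fun u v => inl_injective (φ := mulAutArrow) (by
    rw [← h.map_inl hn, map_mul inl u v, map_mul φ, map_mul inl, ← h.map_inl hn, ← h.map_inl hn])

theorem Covers.map_right (hn : 4 ≤ n) (h : Covers φ τ) (g : SignedPermGroup n) :
    (φ g).right = τ * g.right * τ⁻¹ := by
  rw [← h, ← inl_left_mul_inr_right g, map_mul, mul_right, h.map_inl_right hn, one_mul]
  simp

theorem Covers.map_inl_left_aut (hn : 4 ≤ n) (h : Covers φ τ) (σ : Perm (Fin n))
    (v : Fin n → ℤˣ) (j : Fin n) :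
    (φ (inl ((mulAutArrow σ : MulAut (Fin n → ℤˣ)) v))).left (τ (σ j)) = (φ (inl v)).left (τ j) := by
  have h1 : φ (inl ((mulAutArrow σ : MulAut (Fin n → ℤˣ)) v)) =
      inl ((mulAutArrow (τ * σ * τ⁻¹) : MulAut (Fin n → ℤˣ)) (φ (inl v)).left) := by
    have := mul_inl_mul_inv (inr σ) v
    rw [right_inr] at this
    rw [← this, map_mul, map_mul, map_inv, h.map_inl hn v, mul_inl_mul_inv, h, left_inl]
  rw [h1, left_inl, mulAutArrow_apply]
  simp

/-- The restriction of `φ` to sign vectors is, up to relabelling by `τ`, the equivariant map whose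
matrix has diagonal entries `a` and off-diagonal entries `b`. -/
def HasEntries (φ : SignedPermGroup n →* SignedPermGroup n) (τ : Perm (Fin n)) (a b : ℤˣ) : Prop :=
  ∀ i j, (φ (inl (Pi.mulSingle i (-1)))).left (τ j) = if j = i then a else b

theorem Covers.exists_hasEntries (hn : 4 ≤ n) (h : Covers φ τ) : ∃ a b, HasEntries φ τ a b := by
  set o : Fin n := ⟨0, by omega⟩ with ho
  set e : Fin n := ⟨1, by omega⟩ with he
  have hoe : o ≠ e := by simp [ho, he]
  refine ⟨(φ (inl (Pi.mulSingle o (-1)))).left (τ o),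
    (φ (inl (Pi.mulSingle o (-1)))).left (τ e), fun i j => ?_⟩
  have key : ∀ (σ : Perm (Fin n)) (k : Fin n), σ o = i → σ k = j →
      (φ (inl (Pi.mulSingle i (-1)))).left (τ j) =
        (φ (inl (Pi.mulSingle o (-1)))).left (τ k) := by
    rintro σ k rfl rfl
    rw [← mulAutArrow_mulSingle, h.map_inl_left_aut hn]
  split_ifs with hji
  · exact key (swap o i) o (by simp) (by simp [hji])
  -- This permutation carries (o, e) to (i, j): S_n is transitive on ordered pairs of distinct
  -- indices.
  · refine key (swap o i * swap e (swap o i j)) e ?_ (by simp)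
    have h1 : o ≠ swap o i j := by
      rw [ne_comm, Ne, swap_apply_eq_iff, swap_apply_left]
      exact hji
    rw [mul_apply, swap_apply_of_ne_of_ne hoe h1, swap_apply_left]

/-- As ab = -1, a product of two flips maps to a product of two flips, so the image contains every
sign vector of product 1. The image also surjects onto S_n, so only conjugation by a sign vector w
remains; it multiplies an element with permutation part ρ by w(ρw)⁻¹, which has product 1. -/
theorem HasEntries.normal (hn : 4 ≤ n) (h : Covers φ τ) {a b : ℤˣ} (hab : HasEntries φ τ a b)
    (hne : a ≠ b) : φ.range.Normal := by
  have hprod : a * b = -1 := by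
    rcases Int.units_eq_one_or a with rfl | rfl <;> rcases Int.units_eq_one_or b with rfl | rfl <;>
      simp_all
  have hpair : ∀ i j : Fin n, i ≠ j →
      (inl (Pi.mulSingle i (-1) * Pi.mulSingle j (-1)) : SignedPermGroup n) ∈ φ.range := by
    intro i j hij
    refine ⟨inl (Pi.mulSingle (τ⁻¹ i) (-1)) * inl (Pi.mulSingle (τ⁻¹ j) (-1)), ?_⟩
    rw [map_mul, h.map_inl hn, h.map_inl hn (Pi.mulSingle (τ⁻¹ j) (-1)), ← map_mul]
    congr 1
    ext1 k
    obtain ⟨k, rfl⟩ := τ.surjective k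
    rw [Pi.mul_apply, hab, hab, Pi.mul_apply, Pi.mulSingle_apply, Pi.mulSingle_apply]
    simp only [eq_inv_iff_eq]
    by_cases hi : τ k = i
    · have hj : τ k ≠ j := hi ▸ hij
      simp [hi, hij, hprod]
    · by_cases hj : τ k = j
      · simp [hj, Ne.symm hij, mul_comm b a, hprod]
      · simp [hi, hj, Int.units_mul_self]
  have hE : ∀ (σ : Perm (Fin n)) (v : Fin n → ℤˣ),
      (inl (v * ((mulAutArrow σ : MulAut (Fin n → ℤˣ)) v)⁻¹) : SignedPermGroup n) ∈ φ.range := by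
    intro σ v
    let f : (Fin n → ℤˣ) →* (Fin n → ℤˣ) :=
      MonoidHom.id _ * ((mulAutArrow σ : MulAut (Fin n → ℤˣ)).toMonoidHom)⁻¹
    change v ∈ φ.range.comap ((inl : _ →* SignedPermGroup n).comp f)
    refine mem_of_mulSingle_neg_one_mem (fun i => ?_) v
    change (inl (Pi.mulSingle i (-1) *
      ((mulAutArrow σ : MulAut (Fin n → ℤˣ)) (Pi.mulSingle i (-1)))⁻¹) : SignedPermGroup n) ∈ φ.range
    rw [mulAutArrow_mulSingle, ← Pi.mulSingle_inv, Int.units_inv_eq_self]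
    by_cases hi : σ i = i
    · rw [hi, ← Pi.mulSingle_mul, Int.units_mul_self, Pi.mulSingle_one, map_one]
      exact φ.range.one_mem
    · exact hpair i (σ i) (Ne.symm hi)
  refine ⟨fun g hg x => ?_⟩
  obtain ⟨y, hy⟩ : ∃ y : SignedPermGroup n, (φ y).right = x.right :=
    ⟨inr (τ⁻¹ * x.right * τ), by rw [h]; group⟩
  obtain ⟨w, hw⟩ : ∃ w, x = inl w * φ y :=
    ⟨(x * (φ y)⁻¹).left, by
      rw [← mul_inv_eq_iff_eq_mul]
      exact SemidirectProduct.ext rfl (by rw [mul_right, inv_right, hy]; simp)⟩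
  have hg' : φ y * g * (φ y)⁻¹ ∈ φ.range :=
    mul_mem (mul_mem ⟨y, rfl⟩ hg) (inv_mem ⟨y, rfl⟩)
  have heq : x * g * x⁻¹ = inl (w * ((mulAutArrow (φ y * g * (φ y)⁻¹).right :
      MulAut (Fin n → ℤˣ)) w)⁻¹) * (φ y * g * (φ y)⁻¹) := by
    rw [map_mul inl, map_inv inl, ← mul_inl_mul_inv, hw]
    group
  rw [heq]
  exact mul_mem (hE _ w) hg'

/-- The pure sign vectors in the image are constant. Normality would add the commutator of a flip at
p with an element over `swap p q`, which is negative at p and q but positive at r. -/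
theorem HasEntries.not_normal (hn : 4 ≤ n) (h : Covers φ τ) {a : ℤˣ} (hab : HasEntries φ τ a a) :
    ¬ φ.range.Normal := by
  intro hN
  have hL : ∀ v i j, (φ (inl v)).left i = (φ (inl v)).left j := by
    intro v i j
    have : v ∈ ((Pi.evalMonoidHom (fun _ : Fin n => ℤˣ) i).comp (h.leftHom hn)).eqLocus
        ((Pi.evalMonoidHom (fun _ : Fin n => ℤˣ) j).comp (h.leftHom hn)) := by
      refine mem_of_mulSingle_neg_one_mem (fun k => ?_) v
      change (φ (inl (Pi.mulSingle k (-1)))).left i = (φ (inl (Pi.mulSingle k (-1)))).left j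
      obtain ⟨i, rfl⟩ := τ.surjective i
      obtain ⟨j, rfl⟩ := τ.surjective j
      rw [hab, hab, ite_self, ite_self]
    exact this
  obtain ⟨p, q, r, hpq, hpr, hqr⟩ : ∃ p q r : Fin n, p ≠ q ∧ p ≠ r ∧ q ≠ r :=
    ⟨⟨0, by omega⟩, ⟨1, by omega⟩, ⟨2, by omega⟩, by simp, by simp, by simp⟩
  set g : SignedPermGroup n := φ (inr (τ⁻¹ * swap p q * τ)) with hg
  have hgr : g.right = swap p q := by
    rw [hg, h]
    group
  have hmem : (inl (Pi.mulSingle p (-1) * Pi.mulSingle q (-1)) : SignedPermGroup n) ∈ φ.range := by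
    have h1 : (inl (Pi.mulSingle p (-1)) * g * (inl (Pi.mulSingle p (-1)))⁻¹) * g⁻¹ ∈ φ.range :=
      mul_mem (hN.conj_mem g ⟨_, rfl⟩ _) (inv_mem ⟨_, rfl⟩)
    have h2 : (inl (Pi.mulSingle p (-1)) * g * (inl (Pi.mulSingle p (-1)))⁻¹) * g⁻¹ =
        (inl (Pi.mulSingle p (-1) * Pi.mulSingle q (-1)) : SignedPermGroup n) := by
      have := mul_inl_mul_inv g (Pi.mulSingle p (-1))
      rw [hgr, mulAutArrow_mulSingle, swap_apply_left] at this
      rw [map_mul inl, ← this, ← map_inv, ← Pi.mulSingle_inv, Int.units_inv_eq_self]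
      simp only [mul_assoc]
    rwa [h2] at h1
  obtain ⟨y, hy⟩ := hmem
  have hyr : y.right = 1 := by
    have := h.map_right hn y
    rw [hy, right_inl, eq_comm, mul_inv_eq_one, mul_eq_left] at this
    exact this
  have hy' : y = inl y.left := SemidirectProduct.ext rfl hyr
  have := hL y.left p r
  rw [← hy', hy, left_inl] at this
  simp [hpq, Ne.symm hpr, Ne.symm hqr] at this

/-- Multiplying an endomorphism covering `τ` by the relabelled sign vector of its argument. -/
def twist (hn : 4 ≤ n) (h : Covers φ τ) : SignedPermGroup n →* SignedPermGroup n :=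
  MonoidHom.mk' (fun g => inl ((mulAutArrow τ : MulAut (Fin n → ℤˣ)) g.left) * φ g) fun g k => by
    have h1 := mul_inl_mul_inv (φ g) ((mulAutArrow τ : MulAut (Fin n → ℤˣ)) k.left)
    rw [h.map_right hn, mul_inv_eq_iff_eq_mul] at h1
    have h2 : (mulAutArrow τ : MulAut (Fin n → ℤˣ)) (g * k).left =
        (mulAutArrow τ : MulAut (Fin n → ℤˣ)) g.left *
          (mulAutArrow (τ * g.right * τ⁻¹) : MulAut (Fin n → ℤˣ))
            ((mulAutArrow τ : MulAut (Fin n → ℤˣ)) k.left) := by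
      rw [mul_left, map_mul, map_mul mulAutArrow, map_mul mulAutArrow, map_inv]
      simp
    rw [h2, map_mul, map_mul φ]
    calc _ = inl ((mulAutArrow τ : MulAut (Fin n → ℤˣ)) g.left) * (inl
          ((mulAutArrow (τ * g.right * τ⁻¹) : MulAut (Fin n → ℤˣ))
            ((mulAutArrow τ : MulAut (Fin n → ℤˣ)) k.left)) * φ g) * φ k := by group
      _ = _ := by
        rw [← h1]
        group

theorem twist_apply (hn : 4 ≤ n) (h : Covers φ τ) (g : SignedPermGroup n) :
    twist hn h g = inl ((mulAutArrow τ : MulAut (Fin n → ℤˣ)) g.left) * φ g := rfl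

theorem twist_covers (hn : 4 ≤ n) (h : Covers φ τ) : Covers (twist hn h) τ := fun σ => by
  rw [twist_apply, mul_right, right_inl, one_mul, h]

/-- Uniqueness of τ makes both twists use the same relabelling, and sign vectors square to 1. -/
theorem twist_twist (hn : 4 ≤ n) (h : Covers φ τ) (h' : Covers (twist hn h) τ') :
    twist hn h' = φ := by
  obtain rfl := h'.unique hn (twist_covers hn h)
  ext1 g
  rw [twist_apply, twist_apply, ← mul_assoc, ← map_mul]
  have : ∀ v : Fin n → ℤˣ, v * v = 1 := fun v => funext fun i => Int.units_mul_self _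
  rw [this, map_one, one_mul]

theorem HasEntries.twist (hn : 4 ≤ n) (h : Covers φ τ) {a b : ℤˣ} (hab : HasEntries φ τ a b) :
    HasEntries (twist hn h) τ (-a) b := fun i j => by
  rw [twist_apply, mul_left, left_inl, left_inl, mulAutArrow_mulSingle, right_inl, map_one,
    MulAut.one_apply, Pi.mul_apply, hab, Pi.mulSingle_apply]
  by_cases hji : j = i <;> simp [hji]

theorem twist_range_normal_iff (hn : 4 ≤ n) (h : Covers φ τ) :
    (twist hn h).range.Normal ↔ ¬ φ.range.Normal := by
  obtain ⟨a, b, hab⟩ := h.exists_hasEntries hn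
  by_cases hne : a = b
  · subst hne
    refine iff_of_true ((hab.twist hn h).normal hn (twist_covers hn h) ?_) (hab.not_normal hn h)
    rcases Int.units_eq_one_or a with rfl | rfl <;> decide
  · refine iff_of_false ?_ (not_not_intro (hab.normal hn h hne))
    have hab' := hab.twist hn h
    have : -a = b := by
      rcases Int.units_eq_one_or a with rfl | rfl <;>
        rcases Int.units_eq_one_or b with rfl | rfl <;> simp_all
    rw [this] at hab'
    exact hab'.not_normal hn (twist_covers hn h)

end covers

end SignedPermGroup

/-! ### Comparing the sizes of the two classes -/

namespace SignedPermGroup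

open SemidirectProduct

variable {n : ℕ}

theorem card_covers_normal_eq (hn : 4 ≤ n) :
    Nat.card {φ : SignedPermGroup n →* SignedPermGroup n // (∃ τ, Covers φ τ) ∧ φ.range.Normal} =
      Nat.card {φ : SignedPermGroup n →* SignedPermGroup n //
        (∃ τ, Covers φ τ) ∧ ¬ φ.range.Normal} :=
  Nat.card_congr
    { toFun := fun φ => ⟨twist hn φ.2.1.choose_spec, ⟨_, twist_covers hn φ.2.1.choose_spec⟩,
        fun h => (twist_range_normal_iff hn φ.2.1.choose_spec).1 h φ.2.2⟩
      invFun := fun φ => ⟨twist hn φ.2.1.choose_spec, ⟨_, twist_covers hn φ.2.1.choose_spec⟩,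
        (twist_range_normal_iff hn φ.2.1.choose_spec).2 φ.2.2⟩
      left_inv := fun φ => Subtype.ext (twist_twist hn φ.2.1.choose_spec
        (Exists.choose_spec ⟨_, twist_covers hn φ.2.1.choose_spec⟩))
      right_inv := fun φ => Subtype.ext (twist_twist hn φ.2.1.choose_spec
        (Exists.choose_spec ⟨_, twist_covers hn φ.2.1.choose_spec⟩)) }

/-- Conjugations by permutations cover distinct τ. -/
theorem factorial_le_card_covers (hn : 4 ≤ n) :
    n.factorial ≤
      Nat.card {φ : SignedPermGroup n →* SignedPermGroup n // ∃ τ, Covers φ τ} := by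
  have hcov : ∀ τ : Perm (Fin n),
      Covers (MulAut.conj (inr τ : SignedPermGroup n)).toMonoidHom τ := fun τ σ => by
    change (inr τ * inr σ * (inr τ)⁻¹ : SignedPermGroup n).right = _
    simp
  have hperm : Nat.card (Perm (Fin n)) = n.factorial := by rw [Nat.card_perm, Nat.card_fin]
  rw [← hperm]
  refine Nat.card_le_card_of_injective
    (fun τ => ⟨(MulAut.conj (inr τ : SignedPermGroup n)).toMonoidHom, τ, hcov τ⟩) ?_
  intro τ τ' h
  have h1 := hcov τ
  rw [show (MulAut.conj (inr τ : SignedPermGroup n)).toMonoidHom = _ from congrArg Subtype.val h]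
    at h1
  exact h1.unique hn (hcov τ')

theorem ncard_commInvolutionPairs_le (n : ℕ) :
    (commInvolutionPairs (SignedPermGroup n)).ncard ≤
      4 ^ n * (commInvolutionPairs (Perm (Fin n))).ncard := by
  have hV : Nat.card ((Fin n → ℤˣ) × (Fin n → ℤˣ)) = 4 ^ n := by
    rw [Nat.card_prod, Nat.card_fun, Nat.card_fin, Nat.card_eq_fintype_card, Fintype.card_units_int,
      ← mul_pow]
    norm_num
  rw [← Nat.card_coe_set_eq, ← Nat.card_coe_set_eq, ← hV, ← Nat.card_prod]
  refine Nat.card_le_card_of_injective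
    (fun p => ((p.1.1.left, p.1.2.left), ⟨(p.1.1.right, p.1.2.right), ?_, ?_, ?_⟩)) ?_
  · exact congrArg SemidirectProduct.right p.2.1
  · exact congrArg SemidirectProduct.right p.2.2.1
  · exact congrArg SemidirectProduct.right p.2.2.2
  · rintro p q h
    obtain ⟨h12, h34⟩ := Prod.mk.inj h
    obtain ⟨h1, h2⟩ := Prod.mk.inj h12
    obtain ⟨h3, h4⟩ := Prod.mk.inj (congrArg Subtype.val h34)
    exact Subtype.ext (Prod.ext (SemidirectProduct.ext h1 h3) (SemidirectProduct.ext h2 h4))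

theorem card_not_covers_le (hn : 7 ≤ n) :
    Nat.card {φ : SignedPermGroup n →* SignedPermGroup n // ¬ ∃ τ, Covers φ τ} ≤
      (commInvolutionPairs (SignedPermGroup n)).ncard := by
  have hk : ∀ φ : {φ : SignedPermGroup n →* SignedPermGroup n // ¬ ∃ τ, Covers φ τ},
      ∀ σ ∈ alternatingGroup (Fin n), φ.1 (inr σ) = 1 := fun φ =>
    (covers_or_map_alternatingGroup_eq_one hn φ.1).resolve_left φ.2
  obtain ⟨i, j, hij⟩ : ∃ i j : Fin n, i ≠ j := ⟨⟨0, by omega⟩, ⟨1, by omega⟩, by simp⟩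
  rw [← Nat.card_coe_set_eq]
  refine Nat.card_le_card_of_injective
    (fun φ => ⟨_, mem_commInvolutionPairs (by omega) (hk φ) i j⟩) fun φ ψ h => ?_
  obtain ⟨h1, h2⟩ := Prod.mk.inj (congrArg Subtype.val h)
  exact Subtype.ext (hom_ext_of_alternatingGroup (by omega) hij (hk φ) (hk ψ) h1 h2)

theorem exists_card_not_covers_le : ∃ C : ℝ, ∀ n : ℕ, 7 ≤ n →
    (Nat.card {φ : SignedPermGroup n →* SignedPermGroup n // ¬ ∃ τ, Covers φ τ} : ℝ) ≤
      C * (1 / 2) ^ n *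
        Nat.card {φ : SignedPermGroup n →* SignedPermGroup n // ∃ τ, Covers φ τ} := by
  obtain ⟨C, hC0, hC⟩ := exists_ncard_commInvolutionPairs_perm_le
  refine ⟨C, fun n hn => ?_⟩
  calc (Nat.card {φ : SignedPermGroup n →* SignedPermGroup n // ¬ ∃ τ, Covers φ τ} : ℝ)
      ≤ 4 ^ n * (commInvolutionPairs (Perm (Fin n))).ncard := by
        exact_mod_cast (card_not_covers_le hn).trans (ncard_commInvolutionPairs_le n)
    _ ≤ 4 ^ n * (C * n.factorial / 8 ^ n) := by
        gcongr
        exact hC n (Fin n) (Nat.card_fin n)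
    _ = C * (1 / 2) ^ n * n.factorial := by
        rw [show (8 : ℝ) = 4 * 2 by norm_num, mul_pow]
        field_simp
        simp
    _ ≤ _ := by
        gcongr
        exact factorial_le_card_covers (by omega)

end SignedPermGroup

/-! ### From counts to the limit -/

theorem Nat.card_subtype_eq_add {α : Type*} [Finite α] (P Q : α → Prop) :
    Nat.card {a // P a} = Nat.card {a // Q a ∧ P a} + Nat.card {a // ¬ Q a ∧ P a} := by
  classical
  rw [← Nat.card_sum]
  refine Nat.card_congr ((Equiv.sumCompl fun a : {a // P a} => Q a.1).symm.trans ?_)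
  exact Equiv.sumCongr
    ((Equiv.subtypeSubtypeEquivSubtypeInter P Q).trans (Equiv.subtypeEquivRight fun _ => and_comm))
    ((Equiv.subtypeSubtypeEquivSubtypeInter P fun a => ¬ Q a).trans
      (Equiv.subtypeEquivRight fun _ => and_comm))

theorem abs_uniformProb_sub_half_le {α : Type} [Finite α] [Nonempty α] (P Q : α → Prop) {ε : ℝ}
    (hhalf : Nat.card {a // Q a ∧ P a} = Nat.card {a // Q a ∧ ¬ P a})
    (hsmall : (Nat.card {a // ¬ Q a} : ℝ) ≤ ε * Nat.card {a // Q a}) :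
    |uniformProb α P - 1 / 2| ≤ ε := by
  have h1 := Nat.card_subtype_eq_add P Q
  have h2 : Nat.card {a // Q a} = Nat.card {a // Q a ∧ P a} + Nat.card {a // Q a ∧ ¬ P a} := by
    rw [Nat.card_subtype_eq_add Q P]
    simp only [and_comm]
  have h3 : Nat.card α = Nat.card {a // Q a} + Nat.card {a // ¬ Q a} := by
    have := Nat.card_subtype_eq_add (fun _ : α => True) Q
    simpa only [and_true, Nat.card_congr (Equiv.Set.univ α),
      Nat.card_congr (Equiv.subtypeUnivEquiv (p := fun _ : α => True) fun _ => trivial)] using this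
  have h4 : Nat.card {a // ¬ Q a ∧ P a} ≤ Nat.card {a // ¬ Q a} :=
    Nat.card_le_card_of_injective (fun a => ⟨a.1, a.2.1⟩) fun a b h =>
      Subtype.ext (Subtype.mk.inj h)
  have hpos : 0 < Nat.card α := Nat.card_pos
  rw [uniformProb]
  rw [← hhalf] at h2
  generalize Nat.card α = N at *
  generalize Nat.card {a // P a} = p at *
  generalize Nat.card {a // Q a} = q at *
  generalize Nat.card {a // ¬ Q a} = r at *
  generalize Nat.card {a // Q a ∧ P a} = s at *
  generalize Nat.card {a // ¬ Q a ∧ P a} = t at *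
  subst h1 h2 h3
  have hN : (0 : ℝ) < ((s + s + r : ℕ) : ℝ) := by exact_mod_cast hpos
  have ht : (t : ℝ) ≤ r := by exact_mod_cast h4
  have ht0 : (0 : ℝ) ≤ t := Nat.cast_nonneg _
  have hs0 : (0 : ℝ) ≤ s := Nat.cast_nonneg _
  have hr0 : (0 : ℝ) ≤ r := Nat.cast_nonneg _
  -- The difference is (2t - r)/(2(2s + r)) with 0 ≤ t ≤ r, and r ≤ 2sε.
  rw [div_sub_div _ _ hN.ne' two_ne_zero, abs_div, abs_of_pos (mul_pos hN two_pos),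
    div_le_iff₀ (mul_pos hN two_pos)]
  push_cast at *
  have hε0 : 0 ≤ ε := by
    by_contra! hneg
    nlinarith [mul_nonneg (neg_nonneg.2 hneg.le) (add_nonneg hs0 hs0)]
  have := mul_nonneg hε0 hr0
  rw [abs_le]
  constructor <;> nlinarith

theorem mainTheorem7 :
    Filter.Tendsto
      (fun n : ℕ =>
        uniformProb (SignedPermGroup n →* SignedPermGroup n) (fun φ => φ.range.Normal))
      Filter.atTop (nhds (1 / 2 : ℝ)) := by
  obtain ⟨C, hC⟩ := SignedPermGroup.exists_card_not_covers_le
  rw [tendsto_iff_dist_tendsto_zero]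
  have hlim : Filter.Tendsto (fun n : ℕ => C * (1 / 2 : ℝ) ^ n) Filter.atTop (nhds 0) := by
    simpa using (tendsto_pow_atTop_nhds_zero_of_lt_one (r := (1 / 2 : ℝ)) (by norm_num)
      (by norm_num)).const_mul C
  refine squeeze_zero' (Filter.Eventually.of_forall fun _ => dist_nonneg) ?_ hlim
  filter_upwards [Filter.eventually_ge_atTop 7] with n hn
  rw [Real.dist_eq]
  exact abs_uniformProb_sub_half_le _ (fun φ => ∃ τ, SignedPermGroup.Covers φ τ)
    (SignedPermGroup.card_covers_normal_eq (by omega)) (hC n hn)
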